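/- Let $n,k,i$ be integers with $n\ge 2k>0$ and $3\le i\le k+1$. Write $[n]=\{1,\dots,n\}$ and let $\binom{[n]}{k}$ be the family of all $k$-element subsets of $[n]$. Families $\mathcal A,\mathcal B\subset\binom{[n]}{k}$ are called cross-intersecting if $A\cap B\neq\emptyset$ for all $A\in\mathcal A$, $B\in\mathcal B$. (1) If $\mathcal A,\mathcal B\subset\binom{[n]}{k}$ are cross-intersecting and $|\mathcal B|\ge\binom{n-1}{k-1}+\binom{n-i}{k-i+1}$, then $$|\mathcal A||\mathcal B|\le\Bigl(\binom{n-1}{k-1}+\binom{n-i}{k-i+1}\Bigr)\Bigl(\binom{n-1}{k-1}-\binom{n-i}{k-1}\Bigr).$$ (2) The bound is attained: the families $\mathcal A_i=\{A\in\binom{[n]}{k}: 1\in A,\ [2,i]\cap A\ne\emptyset\}$ and $\mathcal B_i=\{B\in\binom{[n]}{k}: 1\in B\}\cup\{B\in\binom{[n]}{k}: 1\notin B,\ [2,i]\subset B\}$, where $[2,i]=\{2,\dots,i\}$, are cross-intersecting with $|\mathcal A_i|=\binom{n-1}{k-1}-\binom{n-i}{k-1}$ and $|\mathcal B_i|=\binom{n-1}{k-1}+\binom{n-i}{k-i+1}$,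 so that equality holds in (1) for this pair. -/

import Mathlib

namespace CrossInt

/-- `[n] choose k`: the family of all `k`-element subsets of `[n] = {1, …, n}`. -/
def kSubsets (n k : ℕ) : Finset (Finset ℕ) :=
  Finset.powersetCard k (Finset.Icc 1 n)

/-- Two families are cross-intersecting if every member of the first meets every member of
the second. -/
def CrossIntersecting (𝒜 ℬ : Finset (Finset ℕ)) : Prop :=
  ∀ A ∈ 𝒜, ∀ B ∈ ℬ, A ∩ B ≠ ∅

/-- `𝒜ᵢ`: the `k`-subsets of `[n]` that contain `1` and meet `[2, i]`. -/
def exampleA (n k i : ℕ) : Finset (Finset ℕ) :=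
  {A ∈ kSubsets n k | 1 ∈ A ∧ Finset.Icc 2 i ∩ A ≠ ∅}

/-- `ℬᵢ`: the `k`-subsets of `[n]` that contain `1`, together with those that do not contain `1`
but contain all of `[2, i]`. -/
def exampleB (n k i : ℕ) : Finset (Finset ℕ) :=
  {B ∈ kSubsets n k | 1 ∈ B} ∪ {B ∈ kSubsets n k | 1 ∉ B ∧ Finset.Icc 2 i ⊆ B}

end CrossInt

open Finset
open scoped FinsetFamily

namespace CrossInt

/-! By Kruskal–Katona applied to the complements of `ℬ`, `ℬ` may be taken to be an initial segment
of the lexicographic order; only sizes matter, so pairs of families are tracked through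
`CrossSizes`, with the last point of `Fin` in the role of `1`. Since `ℬ` is at least as large as a
star, `𝒜` lies in that star (`CrossSizes.of_star_le`). What remains is a `(k-1)`-uniform and a
`k`-uniform family on `m = n - 1` points, the latter of size `v`, the excess of `ℬ` over the star.

The extremal pairs give points in the plane of sizes, one for each `s = i - 1`. Between consecutive
points, splitting off common points of the lex segment leaves two families to which double counting
applies (`CrossSizes.mul_add_mul_le`), so the sizes lie below the segment joining the points. On a
sufficiently steep segment the product is largest at the end with smaller `ℬ`
(`mul_le_of_below_segment`).

Induction on `s` chains the segments (`CrossSizes.mul_add_choose_le`). From `s = 1` to `s = 2` the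
segment is not steep enough, so the base case subdivides it and uses log-concavity and an explicit
binomial inequality (`CrossSizes.mul_add_choose_le_of_two`). -/

/-- There are cross-intersecting families on `Fin m`, one `a`-uniform of size at least `u`, the
other `b`-uniform of size at least `v`. -/
def CrossSizes (m a b u v : ℕ) : Prop :=
  ∃ 𝒜 ℬ : Finset (Finset (Fin m)),
    (∀ A ∈ 𝒜, #A = a) ∧ (∀ B ∈ ℬ, #B = b) ∧ (∀ A ∈ 𝒜, ∀ B ∈ ℬ, ¬ Disjoint A B) ∧
      u ≤ #𝒜 ∧ v ≤ #ℬ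

/-! ### Size bounds and double counting. -/

lemma card_le_choose {m a : ℕ} {𝒜 : Finset (Finset (Fin m))} (h : ∀ A ∈ 𝒜, #A = a) :
    #𝒜 ≤ m.choose a := by
  have : 𝒜 ⊆ powersetCard a univ := fun A hA => mem_powersetCard.2 ⟨subset_univ _, h A hA⟩
  simpa using card_le_card this

lemma CrossSizes.le_choose_left {m a b u v : ℕ} (h : CrossSizes m a b u v) :
    u ≤ m.choose a := by
  obtain ⟨𝒜, ℬ, hA, -, -, hu, -⟩ := h
  exact hu.trans (card_le_choose hA)

lemma CrossSizes.eq_zero_of_pos {m b u v : ℕ} (h : CrossSizes m 0 b u v) (hv : 0 < v) :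
    u = 0 := by
  obtain ⟨𝒜, ℬ, hA, -, hc, hu, hv'⟩ := h
  obtain ⟨B, hB⟩ := card_pos.1 (hv.trans_le hv')
  by_contra hne
  obtain ⟨A, hA'⟩ := card_pos.1 ((Nat.pos_of_ne_zero hne).trans_le hu)
  refine hc A hA' B hB ?_
  rw [card_eq_zero.1 (hA A hA')]
  exact disjoint_empty_left B

/-- Double counting in the biregular disjointness graph. -/
lemma CrossSizes.mul_add_mul_le {m a b u v : ℕ} (h : CrossSizes m a b u v) (hab : a + b ≤ m) :
    u * m.choose b + v * m.choose a ≤ m.choose a * m.choose b := by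
  obtain ⟨𝒜, ℬ, hA, hB, hc, hu, hv⟩ := h
  have hsub : 𝒜 ⊆ powersetCard a univ := fun A h => mem_powersetCard.2 ⟨subset_univ _, hA A h⟩
  have key := card_mul_le_card_mul (s := ℬ) (t := powersetCard a univ \ 𝒜)
    (m := (m - b).choose a) (n := (m - a).choose b) (fun B A : Finset (Fin m) => Disjoint B A)
    (fun B hBm => by
      have : powersetCard a Bᶜ ⊆
          bipartiteAbove (fun B A : Finset (Fin m) => Disjoint B A)
            (powersetCard a univ \ 𝒜) B := by
        intro A hAm
        rw [mem_powersetCard] at hAm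
        have hd : Disjoint A B := by
          rw [← subset_compl_iff_disjoint_right]
          exact hAm.1
        simp only [mem_bipartiteAbove, mem_sdiff, mem_powersetCard, subset_univ, true_and]
        exact ⟨⟨hAm.2, fun hA' => hc A hA' B hBm hd⟩, hd.symm⟩
      simpa [card_compl, hB B hBm] using card_le_card this)
    (fun A hAm => by
      have hAc : #A = a := (mem_powersetCard.1 (mem_sdiff.1 hAm).1).2
      have : bipartiteBelow (fun B A : Finset (Fin m) => Disjoint B A) ℬ A ⊆
          powersetCard b Aᶜ := by
        intro B hBm
        rw [mem_bipartiteBelow] at hBm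
        exact mem_powersetCard.2 ⟨by rw [subset_compl_iff_disjoint_right]; exact hBm.2, hB B hBm.1⟩
      simpa [card_compl, hAc] using card_le_card this)
  rw [card_sdiff_of_subset hsub, card_powersetCard, card_univ, Fintype.card_fin] at key
  have h𝒜 : #𝒜 ≤ m.choose a := card_le_choose hA
  -- Both sides count disjoint pairs of a `b`-set and an `a`-set.
  have hswap : m.choose b * (m - b).choose a = m.choose a * (m - a).choose b := by
    have h1 := Nat.choose_mul (n := m) (k := a + b) (s := b) (by omega)
    have h2 := Nat.choose_mul (n := m) (k := a + b) (s := a) (by omega)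
    rw [Nat.add_sub_cancel] at h1
    rw [Nat.add_sub_cancel_left] at h2
    rw [← h1, ← h2, Nat.choose_symm_add]
  have hpos : 0 < (m - b).choose a := Nat.choose_pos (by omega)
  obtain ⟨w, hw⟩ := Nat.exists_eq_add_of_le h𝒜
  rw [hw, Nat.add_sub_cancel_left] at key
  have h1 : #ℬ * m.choose a ≤ w * m.choose b := by
    refine Nat.le_of_mul_le_mul_right ?_ hpos
    calc #ℬ * m.choose a * (m - b).choose a
        = #ℬ * (m - b).choose a * m.choose a := by ring
      _ ≤ w * (m - a).choose b * m.choose a := Nat.mul_le_mul_right _ key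
      _ = w * (m.choose a * (m - a).choose b) := by ring
      _ = w * m.choose b * (m - b).choose a := by rw [← hswap]; ring
  calc u * m.choose b + v * m.choose a
      ≤ #𝒜 * m.choose b + #ℬ * m.choose a := by gcongr
    _ ≤ #𝒜 * m.choose b + w * m.choose b := by gcongr
    _ = m.choose a * m.choose b := by rw [hw]; ring

/-! ### Compression to lexicographic initial segments. -/

/-- Colex initial segments of every possible size exist. -/
lemma exists_isInitSeg_card {m r v : ℕ} (hv : v ≤ m.choose r) :
    ∃ 𝒞 : Finset (Finset (Fin m)), Colex.IsInitSeg 𝒞 r ∧ #𝒞 = v := by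
  induction v with
  | zero => exact ⟨∅, Colex.isInitSeg_empty, rfl⟩
  | succ v ih =>
    obtain ⟨𝒞, h𝒞, hcard⟩ := ih (by omega)
    have hne : (powersetCard r (univ : Finset (Fin m)) \ 𝒞).Nonempty := by
      rw [← card_pos]
      have := le_card_sdiff 𝒞 (powersetCard r (univ : Finset (Fin m)))
      rw [card_powersetCard, card_univ, Fintype.card_fin] at this
      omega
    obtain ⟨s, hs, hmin⟩ := exists_min_image _ (fun s : Finset (Fin m) => toColex s) hne
    rw [mem_sdiff, mem_powersetCard] at hs
    refine ⟨insert s 𝒞, ⟨?_, ?_⟩, by rw [card_insert_of_notMem hs.2, hcard]⟩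
    · intro t ht
      rw [coe_insert, Set.mem_insert_iff] at ht
      rcases ht with rfl | ht
      · exact hs.1.2
      · exact h𝒞.1 ht
    · rintro t t' ht ⟨hlt, ht'⟩
      rcases mem_insert.1 ht with rfl | ht
      · by_contra hn
        have : t' ∉ 𝒞 := fun h => hn (mem_insert_of_mem h)
        exact absurd hlt (not_lt.2 (hmin t' (by simp [ht', this])))
      · exact mem_insert_of_mem (h𝒞.2 ht ⟨hlt, ht'⟩)

lemma toColex_lt_of_last {m : ℕ} {s t : Finset (Fin (m + 1))} (hs : Fin.last m ∈ s)
    (ht : Fin.last m ∉ t) : toColex t < toColex s := by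
  rw [Colex.toColex_lt_toColex_iff_exists_forall_lt]
  refine ⟨Fin.last m, hs, ht, fun b hb _ => ?_⟩
  exact lt_of_le_of_ne (Fin.le_last b) (fun h => ht (h ▸ hb))

/-- Cross-intersecting families may be replaced by ones of the same sizes where the second is
an initial segment of the lexicographic order, which either lies in the star of the
last element or contains it. -/
lemma CrossSizes.exists_lex {m a b u v : ℕ} (h : CrossSizes (m + 1) a b u v)
    (hab : a + b ≤ m + 1) :
    ∃ 𝒜 ℬ : Finset (Finset (Fin (m + 1))),
      (∀ A ∈ 𝒜, #A = a) ∧ (∀ B ∈ ℬ, #B = b) ∧ (∀ A ∈ 𝒜, ∀ B ∈ ℬ, ¬ Disjoint A B) ∧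
      u ≤ #𝒜 ∧ v ≤ #ℬ ∧
      ((∀ B ∈ ℬ, Fin.last m ∈ B) ∨ ∀ B, #B = b → Fin.last m ∈ B → B ∈ ℬ) := by
  obtain ⟨𝒜, ℬ, hA, hB, hc, hu, hv⟩ := h
  have hBc : (ℬᶜˢ : Set (Finset (Fin (m + 1)))).Sized (m + 1 - b) := by
    have : (ℬ : Set (Finset (Fin (m + 1)))).Sized b := fun B h => hB B h
    simpa using this.compls
  have hcardle : #ℬᶜˢ ≤ (m + 1).choose (m + 1 - b) := card_le_choose fun A hA => hBc hA
  obtain ⟨𝒞, h𝒞, hcard⟩ := exists_isInitSeg_card hcardle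
  have hkk := iterated_kk (k := m + 1 - b - a) hBc hcard.le h𝒞
  -- The iterated shadow of the complements consists of `a`-sets disjoint from some member of `ℬ`,
  -- so `𝒜` avoids it.
  have hbound : #𝒜 + #(∂^[m + 1 - b - a] ℬᶜˢ) ≤ (m + 1).choose a := by
    rw [← card_union_of_disjoint]
    · refine card_le_choose fun A hAm => ?_
      rcases mem_union.1 hAm with h | h
      · exact hA A h
      · have := hBc.shadow_iterate (k := m + 1 - b - a) h
        omega
    · refine disjoint_left.2 fun A hA' hsh => ?_
      obtain ⟨C, hC, hAC, -⟩ := mem_shadow_iterate_iff_exists_sdiff.1 hsh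
      exact hc A hA' Cᶜ (mem_compls.1 hC) (disjoint_of_subset_left hAC disjoint_compl_right)
  refine ⟨powersetCard a univ \ ∂^[m + 1 - b - a] 𝒞, 𝒞ᶜˢ, ?_, ?_, ?_, ?_, ?_, ?_⟩
  · intro A hAm
    exact (mem_powersetCard.1 (mem_sdiff.1 hAm).1).2
  · intro B hBm
    have h1 := h𝒞.1 (mem_compls.1 hBm)
    rw [card_compl, Fintype.card_fin] at h1
    have := card_le_univ B
    rw [Fintype.card_fin] at this
    omega
  · intro A hAm B hBm hd
    rw [mem_sdiff, mem_powersetCard] at hAm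
    refine hAm.2 (mem_shadow_iterate_iff_exists_mem_card_add.2
      ⟨Bᶜ, mem_compls.1 hBm, subset_compl_iff_disjoint_right.2 hd, ?_⟩)
    have := h𝒞.1 (mem_compls.1 hBm)
    omega
  · have := le_card_sdiff (∂^[m + 1 - b - a] 𝒞) (powersetCard a (univ : Finset (Fin (m + 1))))
    rw [card_powersetCard, card_univ, Fintype.card_fin] at this
    omega
  · rw [card_compls, hcard, card_compls]
    exact hv
  -- In colex every set avoiding the last point precedes every set containing it; one member of `𝒞`
  -- with that point therefore forces the whole star into `𝒞ᶜˢ`.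
  · by_cases hs : ∃ s ∈ 𝒞, Fin.last m ∈ s
    · obtain ⟨s, hs, hl⟩ := hs
      refine Or.inr fun B hBb hlB => mem_compls.2 (h𝒞.2 hs ⟨toColex_lt_of_last hl ?_, ?_⟩)
      · simpa using hlB
      · rw [card_compl, Fintype.card_fin, hBb]
    · push Not at hs
      refine Or.inl fun B hBm => ?_
      simpa using hs _ (mem_compls.1 hBm)

/-! ### Splitting a family at the last point. -/

/-- The members of a family that avoid the last point, as sets of smaller elements. -/
def withoutLast {m : ℕ} (𝒜 : Finset (Finset (Fin (m + 1)))) : Finset (Finset (Fin m)) :=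
  {s | s.map Fin.castSuccEmb ∈ 𝒜}

/-- The members of a family that contain the last point, with that point removed. -/
def withLast {m : ℕ} (𝒜 : Finset (Finset (Fin (m + 1)))) : Finset (Finset (Fin m)) :=
  {s | insert (Fin.last m) (s.map Fin.castSuccEmb) ∈ 𝒜}

lemma last_notMem_map {m : ℕ} (s : Finset (Fin m)) : Fin.last m ∉ s.map Fin.castSuccEmb := by
  simp [Fin.castSucc_ne_last]

lemma card_insert_last {m : ℕ} (s : Finset (Fin m)) :
    #(insert (Fin.last m) (s.map Fin.castSuccEmb)) = #s + 1 := by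
  rw [card_insert_of_notMem (last_notMem_map s), card_map]

lemma exists_map_eq {m : ℕ} {s : Finset (Fin (m + 1))} (hs : Fin.last m ∉ s) :
    ∃ t : Finset (Fin m), t.map Fin.castSuccEmb = s := by
  refine ⟨univ.filter fun x : Fin m => x.castSucc ∈ s, ?_⟩
  ext x
  induction x using Fin.lastCases with
  | last => simpa [Fin.castSucc_ne_last] using hs
  | cast x => simp

lemma card_withoutLast_add_card_withLast {m : ℕ} (𝒜 : Finset (Finset (Fin (m + 1)))) :
    #(withoutLast 𝒜) + #(withLast 𝒜) = #𝒜 := by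
  have h1 : #(withoutLast 𝒜) = #{s ∈ 𝒜 | Fin.last m ∉ s} := by
    refine card_bij (fun s _ => s.map Fin.castSuccEmb) ?_ ?_ ?_
    · intro s hs
      exact mem_filter.2 ⟨(mem_filter.1 hs).2, last_notMem_map s⟩
    · intro s _ t _ h
      exact map_injective _ h
    · intro s hs
      obtain ⟨t, rfl⟩ := exists_map_eq (mem_filter.1 hs).2
      exact ⟨t, mem_filter.2 ⟨mem_univ _, (mem_filter.1 hs).1⟩, rfl⟩
  have h2 : #(withLast 𝒜) = #{s ∈ 𝒜 | ¬ Fin.last m ∉ s} := by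
    refine card_bij (fun s _ => insert (Fin.last m) (s.map Fin.castSuccEmb)) ?_ ?_ ?_
    · intro s hs
      exact mem_filter.2 ⟨(mem_filter.1 hs).2, not_not.2 (mem_insert_self _ _)⟩
    · intro s _ t _ h
      have := congrArg (fun z => z.erase (Fin.last m)) h
      simp only [erase_insert (last_notMem_map _)] at this
      exact map_injective _ this
    · intro s hs
      obtain ⟨hs, hl⟩ := mem_filter.1 hs
      rw [not_not] at hl
      obtain ⟨t, ht⟩ := exists_map_eq (notMem_erase (Fin.last m) s)
      have : insert (Fin.last m) (t.map Fin.castSuccEmb) = s := by rw [ht, insert_erase hl]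
      exact ⟨t, mem_filter.2 ⟨mem_univ _, this ▸ hs⟩, this⟩
  rw [h1, h2, card_filter_add_card_filter_not]

lemma card_of_mem_withoutLast {m a : ℕ} {𝒜 : Finset (Finset (Fin (m + 1)))}
    (h : ∀ A ∈ 𝒜, #A = a) : ∀ A ∈ withoutLast 𝒜, #A = a := fun A hA => by
  simpa using h _ (mem_filter.1 hA).2

lemma card_of_mem_withLast {m a : ℕ} {𝒜 : Finset (Finset (Fin (m + 1)))}
    (h : ∀ A ∈ 𝒜, #A = a + 1) : ∀ A ∈ withLast 𝒜, #A = a := fun A hA => by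
  have := h _ (mem_filter.1 hA).2
  rw [card_insert_last] at this
  omega

/-- If the second family is no larger than a star, it may be taken inside that star. -/
lemma CrossSizes.of_le_star {m a b u v : ℕ} (h : CrossSizes (m + 1) (a + 1) (b + 1) u v)
    (hab : a + b + 1 ≤ m) (hv : v ≤ m.choose b) :
    CrossSizes m (a + 1) b (u - m.choose a) v := by
  obtain ⟨𝒜, ℬ, hA, hB, hc, hu, hvB, hlex⟩ := h.exists_lex (by omega)
  refine ⟨withoutLast 𝒜, withLast ℬ, card_of_mem_withoutLast hA, card_of_mem_withLast hB,
    ?_, ?_, ?_⟩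
  · intro A hAm B hBm hd
    refine hc _ (mem_filter.1 hAm).2 _ (mem_filter.1 hBm).2 ?_
    rw [disjoint_insert_right, disjoint_map]
    exact ⟨last_notMem_map A, hd⟩
  · have h1 := card_withoutLast_add_card_withLast 𝒜
    have h2 := card_le_choose (card_of_mem_withLast hA)
    omega
  · rcases hlex with hlex | hlex
    · have : withoutLast ℬ = ∅ := by
        refine eq_empty_of_forall_notMem fun s hs => ?_
        exact last_notMem_map s (hlex _ (mem_filter.1 hs).2)
      have h1 := card_withoutLast_add_card_withLast ℬ
      rw [this, card_empty] at h1
      omega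
    · have : powersetCard b univ ⊆ withLast ℬ := fun s hs => by
        refine mem_filter.2 ⟨mem_univ _, hlex _ ?_ (mem_insert_self _ _)⟩
        rw [card_insert_last, (mem_powersetCard.1 hs).2]
      have := card_le_card this
      rw [card_powersetCard, card_univ, Fintype.card_fin] at this
      omega

/-- If the second family is at least as large as a star, it may be taken to contain that star,
which forces the first family into the star. -/
lemma CrossSizes.of_star_le {m a b u v : ℕ} (h : CrossSizes (m + 1) (a + 1) (b + 1) u v)
    (hab : a + b + 1 ≤ m) (hv : m.choose b ≤ v) :
    CrossSizes m a (b + 1) u (v - m.choose b) := by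
  obtain ⟨𝒜, ℬ, hA, hB, hc, hu, hvB, hlex⟩ := h.exists_lex (by omega)
  have hcardB := card_withoutLast_add_card_withLast ℬ
  have hBl := card_le_choose (card_of_mem_withLast hB)
  have hfull : ∀ s : Finset (Fin m), #s = b → s ∈ withLast ℬ := by
    rcases hlex with hlex | hlex
    · have h0 : withoutLast ℬ = ∅ := by
        refine eq_empty_of_forall_notMem fun s hs => ?_
        exact last_notMem_map s (hlex _ (mem_filter.1 hs).2)
      rw [h0, card_empty] at hcardB
      have heq : withLast ℬ = powersetCard b univ := by
        refine eq_of_subset_of_card_le (fun s hs => mem_powersetCard.2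
          ⟨subset_univ _, card_of_mem_withLast hB s hs⟩) ?_
        rw [card_powersetCard, card_univ, Fintype.card_fin]
        omega
      intro s hs
      rw [heq]
      exact mem_powersetCard.2 ⟨subset_univ _, hs⟩
    · intro s hs
      refine mem_filter.2 ⟨mem_univ _, hlex _ ?_ (mem_insert_self _ _)⟩
      rw [card_insert_last, hs]
  -- A member of `𝒜` off the last point leaves room for a disjoint `b`-set, which together with the
  -- last point is in `ℬ`.
  have hAempty : withoutLast 𝒜 = ∅ := by
    refine eq_empty_of_forall_notMem fun s hs => ?_
    have hsc := card_of_mem_withoutLast hA s hs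
    obtain ⟨t, hts, htc⟩ := exists_subset_card_eq (s := sᶜ) (n := b)
      (by rw [card_compl, Fintype.card_fin]; omega)
    refine hc _ (mem_filter.1 hs).2 _ (mem_filter.1 (hfull t htc)).2 ?_
    rw [disjoint_insert_right, disjoint_map]
    exact ⟨last_notMem_map s, (subset_compl_iff_disjoint_right.1 hts).symm⟩
  refine ⟨withLast 𝒜, withoutLast ℬ, card_of_mem_withLast hA, card_of_mem_withoutLast hB,
    ?_, ?_, ?_⟩
  · intro A hAm B hBm hd
    refine hc _ (mem_filter.1 hAm).2 _ (mem_filter.1 hBm).2 ?_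
    rw [disjoint_insert_left, disjoint_map]
    exact ⟨last_notMem_map B, hd⟩
  · have h1 := card_withoutLast_add_card_withLast 𝒜
    rw [hAempty, card_empty] at h1
    omega
  · omega

/-! ### Products of sizes along a segment. -/

/-- A point `(a₁ + u', M + v)` below the segment from `(a₁ + y, M)` to `(a₁, M + x)` has a
coordinate product at most that of the first endpoint when the segment is steep enough there. -/
lemma mul_le_of_below_segment {x y a₁ M u v : ℕ} (hx : 0 < x) (hslope : x * (a₁ + y) ≤ y * M)
    (hline : (u - a₁) * x + v * y ≤ x * y) : u * (M + v) ≤ (a₁ + y) * M := by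
  obtain ⟨u', hu'⟩ : ∃ u', u' = u - a₁ := ⟨_, rfl⟩
  rw [← hu'] at hline
  have hu : u ≤ a₁ + u' := by omega
  have hy : u' ≤ y := by
    by_contra! h
    nlinarith [Nat.mul_lt_mul_of_pos_right h hx]
  obtain ⟨w, rfl⟩ := Nat.exists_eq_add_of_le hy
  have h1 : v * (u' + w) ≤ w * x := by nlinarith
  -- Here `w` is the deficit of the first coordinate from `a₁ + y`; the gain from `v` is at most the
  -- loss from `w`.
  have h2 : v * (a₁ + (u' + w)) ≤ w * (M + v) := by
    refine Nat.le_of_mul_le_mul_right ?_ hx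
    calc v * (a₁ + (u' + w)) * x = v * (x * (a₁ + (u' + w))) := by ring
      _ ≤ v * ((u' + w) * M) := Nat.mul_le_mul_left _ hslope
      _ = v * (u' + w) * M := by ring
      _ ≤ w * x * M := Nat.mul_le_mul_right _ h1
      _ ≤ w * x * M + w * x * v := Nat.le_add_right _ _
      _ = w * (M + v) * x := by ring
  calc u * (M + v) ≤ (a₁ + u') * (M + v) := Nat.mul_le_mul_right _ hu
    _ ≤ (a₁ + (u' + w)) * M := by nlinarith

lemma mul_le_of_segment_end {x y a₁ M : ℕ} (hx : 0 < x) (hslope : x * (a₁ + y) ≤ y * M) :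
    a₁ * (M + x) ≤ (a₁ + y) * M :=
  mul_le_of_below_segment hx hslope (by simp)

/-- Compares the proportions of `k`-sets and `c`-sets avoiding a point. -/
lemma choose_mul_choose_succ_le {l k c : ℕ} (hck : c ≤ k) :
    l.choose k * (l + 1).choose c ≤ l.choose c * (l + 1).choose k := by
  rcases lt_or_ge l k with h | h
  · simp [Nat.choose_eq_zero_of_lt h]
  · have h1 := Nat.choose_mul_succ_eq l k
    have h2 := Nat.choose_mul_succ_eq l c
    refine Nat.le_of_mul_le_mul_right ?_ (Nat.succ_pos l)
    calc l.choose k * (l + 1).choose c * (l + 1)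
        = l.choose k * (l + 1) * (l + 1).choose c := by ring
      _ = (l + 1).choose k * (l + 1 - k) * (l + 1).choose c := by rw [h1]
      _ ≤ (l + 1).choose k * (l + 1 - c) * (l + 1).choose c := by gcongr
      _ = (l + 1).choose k * ((l + 1).choose c * (l + 1 - c)) := by ring
      _ = l.choose c * (l + 1).choose k * (l + 1) := by rw [← h2]; ring

/-- Product bound when the second family has already swallowed a star, so that its total size is
`M + v`. -/
lemma CrossSizes.mul_add_le {c t l M u v : ℕ} (h : CrossSizes l c (t + c) u v) (ht : 1 ≤ t)
    (hl : 2 * c + t ≤ l) (hM : l.choose (t + c - 1) ≤ M) :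
    u * (M + v) ≤ l.choose c * M := by
  induction c generalizing t l M u v with
  | zero =>
    rcases Nat.eq_zero_or_pos v with rfl | hv
    · exact Nat.mul_le_mul_right _ h.le_choose_left
    · simp [h.eq_zero_of_pos hv]
  | succ c ih =>
    obtain ⟨l, rfl⟩ : ∃ l', l = l' + 1 := ⟨l - 1, by omega⟩
    rw [← add_assoc, Nat.add_sub_cancel] at hM
    have hx : 0 < l.choose (t + c) := Nat.choose_pos (by omega)
    -- Steepness comes from `c + 1 ≤ t + c`, which is where `1 ≤ t` enters.
    have hslope : l.choose (t + c) * (l.choose c + l.choose (c + 1)) ≤ l.choose (c + 1) * M := by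
      rw [← Nat.choose_succ_succ']
      exact (choose_mul_choose_succ_le (by omega)).trans (Nat.mul_le_mul_left _ hM)
    rw [Nat.choose_succ_succ']
    rw [← add_assoc] at h
    rcases le_total v (l.choose (t + c)) with hv | hv
    · refine mul_le_of_below_segment hx hslope ?_
      have := (h.of_le_star (by omega) hv).mul_add_mul_le (by omega)
      rwa [Nat.mul_comm (l.choose (t + c))]
    -- A second star is absorbed into `M`; the uniformity gap `t` grows by one while `c` drops.
    · have h' := h.of_star_le (by omega) hv
      rw [show t + c + 1 = t + 1 + c by ring] at h'
      have := ih (M := M + l.choose (t + c)) h' (by omega) (by omega) (by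
        rw [show t + 1 + c - 1 = t + c by omega]
        exact Nat.le_add_left _ _)
      rw [show M + l.choose (t + c) + (v - l.choose (t + c)) = M + v by omega] at this
      exact this.trans (mul_le_of_segment_end hx hslope)

/-- While the second family fits in a star, its common point can be removed. Each removal discards
the members of the first family through that point, and Pascal's rule telescopes the losses. -/
lemma CrossSizes.iterate_of_le_star {m k s u v : ℕ} (h : CrossSizes m (k - 1) k u v)
    (hk : 2 ≤ k) (hm : 2 * k ≤ m + 1) (hs : s ≤ k) (hv : v ≤ (m - s).choose (k - s)) :
    CrossSizes (m - s) (k - 1) (k - s) (u - (m.choose (k - 1) - (m - s).choose (k - 1))) v := by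
  induction s with
  | zero => simpa using h
  | succ s ih =>
    obtain ⟨l, hl⟩ : ∃ l, m - s = l + 1 := ⟨m - s - 1, by omega⟩
    obtain ⟨b, hb⟩ : ∃ b, k - s = b + 1 := ⟨k - s - 1, by omega⟩
    obtain ⟨a, rfl⟩ : ∃ a, k = a + 2 := ⟨k - 2, by omega⟩
    have hl' : m - (s + 1) = l := by omega
    have hb' : a + 2 - (s + 1) = b := by omega
    have ha' : a + 2 - 1 = a + 1 := by omega
    rw [hl', hb'] at hv
    rw [hl, hb, ha', Nat.choose_succ_succ', Nat.choose_succ_succ'] at ih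
    rw [hl', hb', ha']
    have hmono : (l + 1).choose (a + 1) ≤ m.choose (a + 1) :=
      Nat.choose_le_choose _ (by omega)
    rw [Nat.choose_succ_succ'] at hmono
    have := (ih (by omega) (by omega)).of_le_star (by omega) hv
    convert this using 1
    omega

/-! ### Binomial inequalities. -/

lemma choose_le_choose_of_le_half {l p q : ℕ} (hpq : p ≤ q) (hq : q ≤ l / 2) :
    l.choose p ≤ l.choose q := by
  induction q, hpq using Nat.le_induction with
  | base => exact le_rfl
  | succ q _ ih =>
    exact (ih (by omega)).trans (Nat.choose_le_succ_of_lt_half_left (by omega))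

lemma choose_le_choose_of_add_le {l p q : ℕ} (hpq : p ≤ q) (hl : p + q ≤ l) :
    l.choose p ≤ l.choose q := by
  rcases le_or_gt q (l / 2) with h | h
  · exact choose_le_choose_of_le_half hpq h
  · rw [← Nat.choose_symm (show q ≤ l by omega)]
    exact choose_le_choose_of_le_half (by omega) (by omega)

/-- Log-concavity of a row of Pascal's triangle. -/
lemma choose_mul_choose_le_sq (l K : ℕ) :
    l.choose (K + 2) * l.choose K ≤ l.choose (K + 1) ^ 2 := by
  have h1 := Nat.choose_succ_right_eq l (K + 1)
  have h2 := Nat.choose_succ_right_eq l K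
  refine Nat.le_of_mul_le_mul_right ?_ (show 0 < K + 2 by omega)
  calc l.choose (K + 2) * l.choose K * (K + 2)
      = l.choose (K + 1 + 1) * (K + 1 + 1) * l.choose K := by ring
    _ = l.choose (K + 1) * (l.choose K * (l - (K + 1))) := by rw [h1]; ring
    _ ≤ l.choose (K + 1) * (l.choose K * (l - K)) := by gcongr; omega
    _ = l.choose (K + 1) ^ 2 * (K + 1) := by rw [← h2]; ring
    _ ≤ l.choose (K + 1) ^ 2 * (K + 2) := by gcongr; omega

/-- Settles the crude corner case of `CrossSizes.mul_add_choose_le_of_two`. All the coefficients are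
rational multiples of `(l + 1).choose (K + 1)`; after substitution the difference of the two sides
is visibly nonnegative. -/
lemma choose_product_le {l K : ℕ} (hl : 2 * K ≤ l) :
    ((l + 1).choose (K + 1) + (l + 1).choose K + l.choose K) *
        (2 * (l + 1).choose (K + 2) + 3 * (l + 1).choose (K + 1) + (l + 1).choose K) ≤
      (2 * (l + 1).choose (K + 1) + (l + 1).choose K) *
        ((l + 1).choose (K + 2) + 3 * (l + 1).choose (K + 1) + (l + 1).choose K) := by
  obtain ⟨d, rfl⟩ : ∃ d, l = K + d := ⟨l - K, by omega⟩
  have hp := Nat.choose_succ_right_eq (K + d + 1) (K + 1)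
  have hr := Nat.choose_succ_right_eq (K + d + 1) K
  have hr' := Nat.add_one_mul_choose_eq (K + d) K
  rw [show K + d + 1 - (K + 1) = d by omega] at hp
  rw [show K + d + 1 - K = d + 1 by omega] at hr
  generalize (K + d + 1).choose (K + 2) = p at *
  generalize (K + d + 1).choose (K + 1) = q at *
  generalize (K + d + 1).choose K = r at *
  generalize (K + d).choose K = r' at *
  zify at hp hr hr' ⊢
  have hp' : (p : ℚ) = q * d / (K + 2) := by
    rw [eq_div_iff (by positivity)]; exact_mod_cast hp
  have hr2 : (r : ℚ) = q * (K + 1) / (d + 1) := by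
    rw [eq_div_iff (by positivity)]; exact_mod_cast hr.symm
  have hr3 : (r' : ℚ) = q * (K + 1) / (K + d + 1) := by
    rw [eq_div_iff (by positivity), mul_comm]; exact_mod_cast hr'
  suffices h : ((q : ℚ) + r + r') * (2 * p + 3 * q + r) ≤ (2 * q + r) * (p + 3 * q + r) by
    exact_mod_cast h
  rw [hp', hr2, hr3, ← sub_nonneg]
  have : (2 * (q : ℚ) + q * (K + 1) / (d + 1)) * (q * d / (K + 2) + 3 * q + q * (K + 1) / (d + 1)) -
      (q + q * (K + 1) / (d + 1) + q * (K + 1) / (K + d + 1)) *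
        (2 * (q * d / (K + 2)) + 3 * q + q * (K + 1) / (d + 1)) =
      q ^ 2 * (2 * (K + 1) * d + 3 * d ^ 2 + 3 * d) / ((K + 2) * (d + 1) * (K + d + 1)) := by
    field_simp
    ring
  rw [this]
  positivity

/-! ### Product bounds in terms of the excess over a star. -/

/-- The product bound when the second family is a star together with at least the sets
containing two further given points. -/
lemma CrossSizes.mul_add_choose_le_of_two {l K u v : ℕ}
    (h : CrossSizes (l + 2) (K + 1) (K + 2) u v) (hl : 2 * K + 1 ≤ l) (hv : l.choose K ≤ v) :
    u * ((l + 2).choose (K + 1) + v) ≤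
      ((l + 2).choose (K + 1) - l.choose (K + 1)) * ((l + 2).choose (K + 1) + l.choose K) := by
  have hq : 0 < l.choose K := Nat.choose_pos (by omega)
  have hp : 0 < l.choose (K + 1) := Nat.choose_pos (by omega)
  have hN : (l + 2).choose (K + 1) = (l + 1).choose K + l.choose K + l.choose (K + 1) := by
    rw [Nat.choose_succ_succ', Nat.choose_succ_succ', add_assoc]
  have hp1 : (l + 1).choose (K + 1) = l.choose K + l.choose (K + 1) := Nat.choose_succ_succ' _ _
  rw [show (l + 2).choose (K + 1) - l.choose (K + 1) = (l + 1).choose K + l.choose K by omega]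
  -- Pascal's rule reduces this to log-concavity; it makes the `s = 2` point at least as good as the
  -- `s = 1` point.
  have hconc : l.choose (K + 1) * (l + 1).choose K ≤
      (l.choose K + (l + 1).choose K) * l.choose K + l.choose (K + 1) * l.choose K := by
    rcases K with _ | K
    · simp
    · have := choose_mul_choose_le_sq l K
      rw [Nat.choose_succ_succ' l K]
      nlinarith
  have hstar : (l + 1).choose K * ((l + 2).choose (K + 1) + (l + 1).choose (K + 1)) ≤
      ((l + 1).choose K + l.choose K) * ((l + 2).choose (K + 1) + l.choose K) := by
    rw [hN, hp1]
    nlinarith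
  rcases le_total ((l + 1).choose (K + 1)) v with hv1 | hv1
  · have h1 := h.of_star_le (by omega) hv1
    have h2 := CrossSizes.mul_add_le (t := 2) (M := (l + 2).choose (K + 1) + (l + 1).choose (K + 1))
      (by rwa [Nat.add_comm 2 K]) (by omega) (by omega)
      (by rw [show 2 + K - 1 = K + 1 by omega]; exact Nat.le_add_left _ _)
    rw [show (l + 2).choose (K + 1) + (l + 1).choose (K + 1) + (v - (l + 1).choose (K + 1)) =
      (l + 2).choose (K + 1) + v by omega] at h2
    exact h2.trans hstar
  · have h1 := (h.of_le_star (by omega) hv1).of_star_le (by omega) hv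
    rcases K with _ | K
    · simp only [Nat.choose_zero_right, zero_add] at *
      rcases hv.eq_or_lt with rfl | hv
      · have := h1.le_choose_left
        rw [Nat.choose_zero_right] at this
        exact Nat.mul_le_mul_right _ (by omega)
      · have := h1.eq_zero_of_pos (by omega)
        calc u * ((l + 2).choose 1 + v) ≤ 1 * ((l + 2).choose 1 + (l + 1).choose 1) := by
              gcongr
              omega
          _ ≤ _ := hstar
    · obtain ⟨l, rfl⟩ : ∃ l', l = l' + 1 := ⟨l - 1, by omega⟩
      simp only [add_assoc, Nat.reduceAdd] at h1 hN hp1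
      simp only [add_assoc, Nat.reduceAdd] at hv hv1 hstar ⊢
      have hqs := Nat.choose_succ_succ' l K
      have hr : (l + 2).choose (K + 1) = (l + 1).choose K + (l + 1).choose (K + 1) :=
        Nat.choose_succ_succ' (l + 1) K
      -- The stretch between the two points is cut again. Its first piece has equal legs, so
      -- steepness only needs `a₁ + y ≤ M`; on the rest the maximal values of both coordinates
      -- suffice.
      rcases le_total (v - (l + 1).choose (K + 1)) (l.choose (K + 1)) with hv2 | hv2
      · have h2 := (h1.of_le_star (by omega) hv2).mul_add_mul_le (by omega)
        have h3 := mul_le_of_below_segment (x := l.choose (K + 1)) (y := l.choose (K + 1))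
          (a₁ := (l + 2).choose (K + 1) + l.choose K)
          (M := (l + 3).choose (K + 2) + (l + 1).choose (K + 1))
          (u := u) (v := v - (l + 1).choose (K + 1)) (Nat.choose_pos (by omega))
          (Nat.mul_le_mul_left _ (by omega)) (by
            rw [← Nat.sub_sub]
            exact h2)
        rw [show (l + 3).choose (K + 2) + (l + 1).choose (K + 1) + (v - (l + 1).choose (K + 1)) =
          (l + 3).choose (K + 2) + v by omega,
          show (l + 2).choose (K + 1) + l.choose K + l.choose (K + 1) =
            (l + 2).choose (K + 1) + (l + 1).choose (K + 1) by omega] at h3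
        exact h3
      · have h2 := (h1.of_star_le (by omega) hv2).le_choose_left
        have h3 := choose_product_le (l := l) (K := K) (by omega)
        calc u * ((l + 3).choose (K + 2) + v)
            ≤ ((l + 1).choose (K + 1) + (l + 1).choose K + l.choose K) *
              (2 * (l + 1).choose (K + 2) + 3 * (l + 1).choose (K + 1) + (l + 1).choose K) :=
              Nat.mul_le_mul (by omega) (by omega)
          _ ≤ _ := h3
          _ = _ := by
              congr 1 <;> omega

/-- For `v` beyond the threshold of `s`, the bound for `s` applies and is compared with that for `s
+ 1`; for `v` between the two thresholds, double counting puts the sizes below the joining segment.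
-/
lemma CrossSizes.mul_add_choose_le {m k s u v : ℕ} (h : CrossSizes m (k - 1) k u v)
    (hm : 2 * k ≤ m + 1) (hs : 2 ≤ s) (hsk : s ≤ k) (hv : (m - s).choose (k - s) ≤ v) :
    u * (m.choose (k - 1) + v) ≤
      (m.choose (k - 1) - (m - s).choose (k - 1)) * (m.choose (k - 1) + (m - s).choose (k - s)) := by
  induction s, hs using Nat.le_induction generalizing u v with
  | base =>
    obtain ⟨K, rfl⟩ : ∃ K, k = K + 2 := ⟨k - 2, by omega⟩
    obtain ⟨l, rfl⟩ : ∃ l, m = l + 2 := ⟨m - 2, by omega⟩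
    simp only [Nat.add_sub_cancel, show K + 2 - 1 = K + 1 by omega] at h hv ⊢
    exact h.mul_add_choose_le_of_two (by omega) hv
  | succ s hs ih =>
    obtain ⟨l, hl⟩ : ∃ l, m - s = l + 1 := ⟨m - s - 1, by omega⟩
    obtain ⟨b, hb⟩ : ∃ b, k - s = b + 1 := ⟨k - s - 1, by omega⟩
    obtain ⟨a, hk⟩ : ∃ a, k = a + 2 := ⟨k - 2, by omega⟩
    have hl' : m - (s + 1) = l := by omega
    have hb' : k - (s + 1) = b := by omega
    have ha' : k - 1 = a + 1 := by omega
    have hit := fun hv => h.iterate_of_le_star (s := s) (by omega) hm (by omega) hv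
    have hmono : (l + 1).choose (a + 1) ≤ m.choose (a + 1) :=
      Nat.choose_le_choose _ (by omega)
    have hpas := Nat.choose_succ_succ' l a
    have hpas' := Nat.choose_succ_succ' l b
    have ih' := fun hv => ih h (by omega) hv
    rw [hl, hb, ha'] at hit ih'
    rw [hl', hb'] at hv
    rw [hl', hb', ha']
    have hx : 0 < l.choose (b + 1) := Nat.choose_pos (by omega)
    -- Steepness needs `b + 1 ≤ a`, which is exactly `2 ≤ s`.
    have hslope : l.choose (b + 1) *
        (m.choose (a + 1) - (l + 1).choose (a + 1) + l.choose a) ≤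
        l.choose a * (m.choose (a + 1) + l.choose b) :=
      Nat.mul_le_mul (choose_le_choose_of_add_le (by omega) (by omega)) (by omega)
    rw [show m.choose (a + 1) - l.choose (a + 1) =
      m.choose (a + 1) - (l + 1).choose (a + 1) + l.choose a by omega]
    rcases le_total ((l + 1).choose (b + 1)) v with hvs | hvs
    · refine (ih' hvs).trans ?_
      have := mul_le_of_segment_end hx hslope
      rwa [add_assoc, ← hpas'] at this
    · have h1 := ((hit hvs).of_star_le (by omega) hv).mul_add_mul_le (by omega)
      have := mul_le_of_below_segment hx hslope (u := u) (v := v - l.choose b)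
        (by rwa [Nat.mul_comm (l.choose (b + 1))])
      rwa [show m.choose (a + 1) + l.choose b + (v - l.choose b) = m.choose (a + 1) + v by omega]
        at this

/-! ### Transfer to `Fin n` and the extremal pair. -/

lemma CrossIntersecting.crossSizes {n k : ℕ} {𝒜 ℬ : Finset (Finset ℕ)}
    (hc : CrossIntersecting 𝒜 ℬ) (hA : 𝒜 ⊆ kSubsets n k) (hB : ℬ ⊆ kSubsets n k) :
    CrossSizes n k k #𝒜 #ℬ := by
  let f : Fin n ↪ ℕ := ⟨fun x => x + 1, fun x y h => Fin.ext (by simpa using h)⟩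
  have hf : univ.map f = Icc 1 n := by
    ext x
    simp only [mem_map, mem_univ, true_and, mem_Icc]
    constructor
    · rintro ⟨y, rfl⟩
      exact ⟨Nat.succ_pos _, y.2⟩
    · rintro ⟨h1, h2⟩
      exact ⟨⟨x - 1, by omega⟩, Nat.sub_add_cancel h1⟩
  have hpull : ∀ 𝒞 ⊆ kSubsets n k,
      #𝒞 = #(univ.filter fun s : Finset (Fin n) => s.map f ∈ 𝒞) := by
    intro 𝒞 h𝒞
    refine (card_bij (fun s _ => s.map f) (fun s hs => (mem_filter.1 hs).2)
      (fun s _ t _ h => map_injective f h) fun s hs => ?_).symm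
    have := (mem_powersetCard.1 (h𝒞 hs)).1
    rw [← hf] at this
    obtain ⟨t, -, rfl⟩ := subset_map_iff.1 this
    exact ⟨t, mem_filter.2 ⟨mem_univ _, hs⟩, rfl⟩
  have hcard : ∀ 𝒞 ⊆ kSubsets n k,
      ∀ s ∈ univ.filter fun s : Finset (Fin n) => s.map f ∈ 𝒞, #s = k := by
    intro 𝒞 h𝒞 s hs
    simpa using (mem_powersetCard.1 (h𝒞 (mem_filter.1 hs).2)).2
  refine ⟨_, _, hcard 𝒜 hA, hcard ℬ hB, fun s hs t ht hd => ?_, (hpull 𝒜 hA).le,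
    (hpull ℬ hB).le⟩
  exact hc _ (mem_filter.1 hs).2 _ (mem_filter.1 ht).2
    (disjoint_iff_inter_eq_empty.1 ((disjoint_map f).2 hd))

lemma card_filter_kSubsets_subset_disjoint {n k : ℕ} {S T : Finset ℕ} (hS : S ⊆ Icc 1 n)
    (hT : T ⊆ Icc 1 n) (hST : Disjoint S T) (hk : #S ≤ k) :
    #{B ∈ kSubsets n k | S ⊆ B ∧ Disjoint T B} = (n - #S - #T).choose (k - #S) := by
  have hbase : #(Icc 1 n \ (S ∪ T)) = n - #S - #T := by
    rw [card_sdiff_of_subset (union_subset hS hT), card_union_of_disjoint hST, Nat.card_Icc]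
    omega
  rw [← hbase, ← card_powersetCard]
  refine (card_bij (fun X _ => X ∪ S) ?_ ?_ ?_).symm
  · intro X hX
    obtain ⟨hX, hXc⟩ := mem_powersetCard.1 hX
    have hd := (disjoint_sdiff (s := S ∪ T) (t := Icc 1 n)).mono_right hX
    rw [disjoint_union_left] at hd
    refine mem_filter.2 ⟨mem_powersetCard.2 ⟨union_subset (hX.trans sdiff_subset) hS, ?_⟩,
      subset_union_right, disjoint_union_right.2 ⟨hd.2, hST.symm⟩⟩
    rw [card_union_of_disjoint hd.1.symm, hXc]
    omega
  · intro X hX Y hY h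
    have hdis : ∀ Z ∈ powersetCard (k - #S) (Icc 1 n \ (S ∪ T)), Disjoint Z S := fun Z hZ =>
      ((disjoint_sdiff.mono_right (mem_powersetCard.1 hZ).1).mono_left subset_union_left).symm
    rw [← union_sdiff_cancel_right (hdis X hX), ← union_sdiff_cancel_right (hdis Y hY)]
    exact congrArg (· \ S) h
  · intro B hB
    obtain ⟨hB, hSB, hTB⟩ := mem_filter.1 hB
    obtain ⟨hB, hBc⟩ := mem_powersetCard.1 hB
    refine ⟨B \ S, mem_powersetCard.2 ⟨?_, ?_⟩, sdiff_union_of_subset hSB⟩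
    · intro x hx
      obtain ⟨hxB, hxS⟩ := mem_sdiff.1 hx
      refine mem_sdiff.2 ⟨hB hxB, ?_⟩
      rw [mem_union, not_or]
      exact ⟨hxS, fun hxT => disjoint_left.1 hTB hxT hxB⟩
    · rw [card_sdiff_of_subset hSB, hBc]

lemma card_star {n k : ℕ} (hn : 1 ≤ n) (hk : 1 ≤ k) :
    #{B ∈ kSubsets n k | 1 ∈ B} = (n - 1).choose (k - 1) := by
  have := card_filter_kSubsets_subset_disjoint (n := n) (k := k) (S := {1}) (T := ∅)
    (by simpa using hn) (empty_subset _) (disjoint_empty_right _) (by simpa using hk)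
  simpa using this

lemma card_exampleA_add {n k i : ℕ} (hi : 1 ≤ i) (hin : i ≤ n) (hk : 1 ≤ k) :
    #(exampleA n k i) + (n - i).choose (k - 1) = (n - 1).choose (k - 1) := by
  have h := card_filter_kSubsets_subset_disjoint (n := n) (k := k) (S := {1}) (T := Icc 2 i)
    (by simpa using hi.trans hin) (Icc_subset_Icc (by omega) hin) (by simp) (by simpa using hk)
  rw [card_singleton, Nat.card_Icc, show n - 1 - (i + 1 - 2) = n - i by omega] at h
  rw [← h, ← card_star (hi.trans hin) hk,
    ← card_filter_add_card_filter_not (s := {B ∈ kSubsets n k | 1 ∈ B})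
      (fun B => Icc 2 i ∩ B ≠ ∅), filter_filter, filter_filter]
  simp only [exampleA, singleton_subset_iff, disjoint_iff_inter_eq_empty, not_not]

lemma card_exampleB {n k i : ℕ} (hi : 2 ≤ i) (hin : i ≤ n) (hik : i ≤ k + 1) :
    #(exampleB n k i) = (n - 1).choose (k - 1) + (n - i).choose (k + 1 - i) := by
  have h := card_filter_kSubsets_subset_disjoint (n := n) (k := k) (S := Icc 2 i) (T := {1})
    (Icc_subset_Icc (by omega) hin) (by simp; omega) (by simp) (by simp; omega)
  rw [card_singleton, Nat.card_Icc, show n - (i + 1 - 2) - 1 = n - i by omega,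
    show k - (i + 1 - 2) = k + 1 - i by omega] at h
  rw [exampleB, card_union_of_disjoint, card_star (by omega) (by omega), ← h]
  · congr 2
    ext B
    simp [and_comm]
  · exact disjoint_filter.2 fun B _ h1 h2 => h2.1 h1

lemma crossIntersecting_examples {n k i : ℕ} :
    CrossIntersecting (exampleA n k i) (exampleB n k i) := by
  intro A hA B hB
  obtain ⟨-, h1, hA⟩ := mem_filter.1 hA
  rw [← nonempty_iff_ne_empty] at hA ⊢
  rcases mem_union.1 hB with hB | hB
  · exact ⟨1, mem_inter.2 ⟨h1, (mem_filter.1 hB).2⟩⟩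
  · obtain ⟨x, hx⟩ := hA
    exact ⟨x, mem_inter.2 ⟨(mem_inter.1 hx).2, (mem_filter.1 hB).2.2 (mem_inter.1 hx).1⟩⟩

end CrossInt

theorem theorem2 (n k i : ℕ) (hn : 2 * k ≤ n) (hk : 0 < k) (hi3 : 3 ≤ i) (hik : i ≤ k + 1) :
    (∀ 𝒜 ℬ : Finset (Finset ℕ),
      𝒜 ⊆ CrossInt.kSubsets n k → ℬ ⊆ CrossInt.kSubsets n k →
      CrossInt.CrossIntersecting 𝒜 ℬ →
      (n - 1).choose (k - 1) + (n - i).choose (k + 1 - i) ≤ ℬ.card →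
      (𝒜.card : ℤ) * (ℬ.card : ℤ) ≤
        (((n - 1).choose (k - 1) : ℤ) + ((n - i).choose (k + 1 - i) : ℤ)) *
          (((n - 1).choose (k - 1) : ℤ) - ((n - i).choose (k - 1) : ℤ))) ∧
    (CrossInt.exampleA n k i ⊆ CrossInt.kSubsets n k ∧
      CrossInt.exampleB n k i ⊆ CrossInt.kSubsets n k ∧
      CrossInt.CrossIntersecting (CrossInt.exampleA n k i) (CrossInt.exampleB n k i) ∧
      ((CrossInt.exampleA n k i).card : ℤ) =
        ((n - 1).choose (k - 1) : ℤ) - ((n - i).choose (k - 1) : ℤ) ∧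
      ((CrossInt.exampleB n k i).card : ℤ) =
        ((n - 1).choose (k - 1) : ℤ) + ((n - i).choose (k + 1 - i) : ℤ) ∧
      ((CrossInt.exampleA n k i).card : ℤ) * ((CrossInt.exampleB n k i).card : ℤ) =
        (((n - 1).choose (k - 1) : ℤ) + ((n - i).choose (k + 1 - i) : ℤ)) *
          (((n - 1).choose (k - 1) : ℤ) - ((n - i).choose (k - 1) : ℤ))) := by

  have hA := CrossInt.card_exampleA_add (n := n) (k := k) (i := i) (by omega) (by omega) hk
  have hB := CrossInt.card_exampleB (n := n) (k := k) (i := i) (by omega) (by omega) hik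
  have hA' : ((CrossInt.exampleA n k i).card : ℤ) =
      ((n - 1).choose (k - 1) : ℤ) - ((n - i).choose (k - 1) : ℤ) := by
    rw [← hA]
    push_cast
    ring
  have hB' : ((CrossInt.exampleB n k i).card : ℤ) =
      ((n - 1).choose (k - 1) : ℤ) + ((n - i).choose (k + 1 - i) : ℤ) := by
    rw [hB]
    push_cast
    ring
  refine ⟨fun 𝒜 ℬ h𝒜 hℬ hc hcard => ?_, Finset.filter_subset _ _,
    Finset.union_subset (Finset.filter_subset _ _) (Finset.filter_subset _ _),
    CrossInt.crossIntersecting_examples, hA', hB', by rw [hA', hB', mul_comm]⟩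
  have h := hc.crossSizes h𝒜 hℬ
  obtain ⟨m, rfl⟩ : ∃ m, n = m + 1 := ⟨n - 1, by omega⟩
  obtain ⟨a, rfl⟩ : ∃ a, k = a + 1 := ⟨k - 1, by omega⟩
  obtain ⟨s, rfl⟩ : ∃ s, i = s + 1 := ⟨i - 1, by omega⟩
  rw [Nat.add_sub_cancel, Nat.add_sub_cancel, Nat.add_sub_add_right, Nat.add_sub_add_right] at *
  -- Removing the star leaves the excess of `ℬ`, to which the bound with `s = i - 1` applies.
  have hstar := h.of_star_le (v := ℬ.card) (b := a) (by omega) (by omega)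
  have hbound := CrossInt.CrossSizes.mul_add_choose_le (k := a + 1) (s := s) hstar (by omega) (by omega) (by omega) (by omega)
  rw [Nat.add_sub_cancel, ← hA, Nat.add_sub_cancel, hA,
    show m.choose a + (ℬ.card - m.choose a) = ℬ.card by omega] at hbound
  rw [← hA', mul_comm (_ + _)]
  exact_mod_cast hbound
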